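/- \textbf{Theorem 1 (Tracking Theorem).} Let $\mathcal X$ be a non-empty compact metric space and $S:\mathcal X\to\mathcal X$ a continuous map. Let $\mathcal Y$ be a Polish space, $T:\mathcal Y\to\mathcal Y$ a Borel measurable map, and $\nu$ a Borel probability measure on $\mathcal Y$ that is invariant and ergodic under $T$. Let $c:\mathcal X\times\mathcal Y\to\mathbb R$ be lower semicontinuous, and suppose that there is a function $c^*\in L^1(\nu)$ with $\sup_{x\in\mathcal X}|c(x,y)|\le c^*(y)$ for all $y\in\mathcal Y$. Let $\mathcal J(S:\nu)$ be the set of all joinings of $(\mathcal X,S,\mu)$ and $(\mathcal Y,T,\nu)$, where $\mu$ ranges over all $S$-invariant Borel probability measures on $\mathcal X$; that is, the set of all Borel probability measures $\lambda$ on $\mathcal X\times\mathcal Y$ that are invariant under $S\times T$ and have an $S$-invariant $\mathcal X$-marginal $\mu$ and $\mathcal Y$-marginal $\nu$. Then $c$ is $\lambda$-integrable for every $\lambda\in\mathcal J(S:\nu)$, the infimum $$C(S:\nu)=\inf_{\lambda\in\mathcal J(S:\nu)}\int c\,d\lambda$$ is a well-defined real number, and for $\nu$-almost every $y\in\mathcal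 Y$ the following limit exists and satisfies $$\lim_{n\to\infty}\ \inf_{x\in\mathcal X}\ \frac1n\sum_{k=0}^{n-1}c(S^kx,T^ky)=C(S:\nu),$$ where $S^k$ and $T^k$ denote $k$-fold compositions. Furthermore, the infimum defining $C(S:\nu)$ is attained: there is $\lambda\in\mathcal J(S:\nu)$ with $\int c\,d\lambda=C(S:\nu)$. -/

import Mathlib

open MeasureTheory Filter Topology

namespace Tracking

variable {X Y : Type*} [MeasurableSpace X] [MeasurableSpace Y]

/-- `IsJoining S T μ ν lam`: `lam` is a joining of the systems `(X, S, μ)` and `(Y, T, ν)`, that is,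
a probability measure on `X × Y` that is invariant under `S × T` and has marginals `μ` and `ν`. -/
structure IsJoining (S : X → X) (T : Y → Y) (μ : Measure X) (ν : Measure Y)
    (lam : Measure (X × Y)) : Prop where
  isProbabilityMeasure : IsProbabilityMeasure lam
  measurePreserving : MeasurePreserving (Prod.map S T) lam lam
  map_fst : lam.map Prod.fst = μ
  map_snd : lam.map Prod.snd = ν

/-- The family `𝒥(S : ν)` of all joinings of `(X, S, μ)` and `(Y, T, ν)`, where `μ` ranges over all
`S`-invariant probability measures on `X`. -/
def joinings (S : X → X) (T : Y → Y) (ν : Measure Y) : Set (Measure (X × Y)) :=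
  {lam | ∃ μ : Measure X, IsProbabilityMeasure μ ∧ MeasurePreserving S μ μ ∧
    IsJoining S T μ ν lam}

/-- The expected costs `∫ c ∂lam` of the joinings `lam ∈ 𝒥(S : ν)`. -/
def joiningCosts (S : X → X) (T : Y → Y) (ν : Measure Y) (c : X × Y → ℝ) : Set ℝ :=
  {r | ∃ lam ∈ joinings S T ν, ∫ p, c p ∂lam = r}

/-- The optimal cost `C(S : ν)`, the infimum of the expected costs over `𝒥(S : ν)`. -/
noncomputable def optimalCost (S : X → X) (T : Y → Y) (ν : Measure Y) (c : X × Y → ℝ) : ℝ :=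
  sInf (joiningCosts S T ν c)

end Tracking

/-! Write m_n(y) for the infimum over x of the n-step cost (`minSum`) and L for the supremum over n
≥ 1 of (1/n) ∫ m_n dν. Integrating m_n(y) ≤ (cost sum along (x, y)) gives L ≤ ∫ c dλ for every
joining λ (`integral_minSum_le`). Conversely, lifting ν to the graph of a measurable near-minimizer,
averaging along S × T and taking a weak limit produces a joining of cost at most L
(`exists_measurePreserving_integral_le`). Hence L is the optimal cost and it is attained. The limit
is invariant although T is only measurable: all measures share the marginal ν, so convergence also
holds for products f(x)g(y) with g merely in L¹(ν) (`tendsto_integral_mul`).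

For the pointwise limit, averaging over all blocks of length m in a long orbit and applying
Birkhoff's theorem on Y bounds the liminf below by (1/m) ∫ m_m dν
(`ae_forall_lt_eventually_lt_minSum`). For the limsup, let λ be a joining and q > ∫ c dλ. If m_n -
nq were not ν-a.e. bounded above, ergodicity would make it unbounded a.e.; then so are the sums of c
- q, λ-a.e., and the maximal ergodic theorem gives q ≤ ∫ c dλ, a contradiction
(`ae_forall_gt_eventually_minSum_lt`). This needs no ergodicity of λ. -/

namespace Tracking

/-! ### Maximal and pointwise ergodic theorems. -/

section Ergodic

variable {Ω : Type*} {T : Ω → Ω} {g : Ω → ℝ}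

/-- The running maximum `max (0, S₁ g, …, Sₙ g)` of the Birkhoff sums of `g`. -/
noncomputable def birkhoffMax (T : Ω → Ω) (g : Ω → ℝ) : ℕ → Ω → ℝ
  | 0 => fun _ => 0
  | n + 1 => fun ω => max 0 (g ω + birkhoffMax T g n (T ω))

lemma birkhoffMax_nonneg (n : ℕ) (ω : Ω) : 0 ≤ birkhoffMax T g n ω := by
  cases n with
  | zero => exact le_rfl
  | succ n => exact le_max_left _ _

lemma birkhoffMax_le_succ (n : ℕ) (ω : Ω) :
    birkhoffMax T g n ω ≤ birkhoffMax T g (n + 1) ω := by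
  induction n generalizing ω with
  | zero => exact birkhoffMax_nonneg _ _
  | succ n ih => exact max_le_max le_rfl (by gcongr; exact ih _)

lemma birkhoffMax_monotone (ω : Ω) : Monotone fun n => birkhoffMax T g n ω :=
  monotone_nat_of_le_succ fun n => birkhoffMax_le_succ n ω

lemma birkhoffSum_le_birkhoffMax (n : ℕ) (ω : Ω) :
    birkhoffSum T g n ω ≤ birkhoffMax T g n ω := by
  induction n generalizing ω with
  | zero => simp [birkhoffMax]
  | succ n ih =>
    rw [birkhoffSum_succ']
    exact le_max_of_le_right (by gcongr; exact ih _)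

lemma birkhoffSum_sub_const (q : ℝ) (n : ℕ) (ω : Ω) :
    birkhoffSum T (fun ω => g ω - q) n ω = birkhoffSum T g n ω - n * q := by
  simp [birkhoffSum]

variable [MeasurableSpace Ω] {μ : Measure Ω}

lemma integrable_birkhoffMax (hT : MeasurePreserving T μ μ) (hg : Integrable g μ) (n : ℕ) :
    Integrable (birkhoffMax T g n) μ := by
  induction n with
  | zero => exact integrable_zero _ _ _
  | succ n ih => exact (integrable_zero _ _ _).sup (hg.add (hT.integrable_comp_of_integrable ih))

/-- **Maximal ergodic theorem**, when almost every point has a positive Birkhoff sum. -/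
theorem integral_nonneg_of_exists_birkhoffSum_pos (hT : MeasurePreserving T μ μ)
    (hg : Integrable g μ) (h : ∀ᵐ ω ∂μ, ∃ n, 0 < birkhoffSum T g n ω) : 0 ≤ ∫ ω, g ω ∂μ := by
  let P (n : ℕ) : Set Ω := {ω | 0 < birkhoffMax T g (n + 1) ω}
  have hP (n : ℕ) : NullMeasurableSet (P n) μ :=
    nullMeasurableSet_lt aemeasurable_const (integrable_birkhoffMax hT hg _).aemeasurable
  have hind (n : ℕ) : Integrable ((P n).indicator g) μ := hg.indicator₀ (hP n)
  have hnonneg (n : ℕ) : 0 ≤ ∫ ω, (P n).indicator g ω ∂μ := by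
    have hM := integrable_birkhoffMax hT hg
    have hMT : Integrable (fun ω => birkhoffMax T g n (T ω)) μ :=
      hT.integrable_comp_of_integrable (hM n)
    -- On `P n` the recursion gives M_{n+1} - M_n ∘ T = g, and off it the difference is at most 0.
    -- By invariance and monotonicity in n its integral is nonnegative.
    have h1 : ∫ ω, (birkhoffMax T g (n + 1) ω - birkhoffMax T g n (T ω)) ∂μ
        ≤ ∫ ω, (P n).indicator g ω ∂μ := by
      refine integral_mono ((hM (n + 1)).sub hMT) (hind n) fun ω => ?_
      by_cases hω : ω ∈ P n
      · have h2 : birkhoffMax T g (n + 1) ω = g ω + birkhoffMax T g n (T ω) := by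
          have h3 : 0 < max 0 (g ω + birkhoffMax T g n (T ω)) := hω
          change max 0 (g ω + birkhoffMax T g n (T ω)) = _
          exact max_eq_right (by by_contra! h4; rw [max_eq_left h4.le] at h3; exact h3.false)
        simp [Set.indicator_of_mem hω, h2]
      · have h2 : birkhoffMax T g (n + 1) ω ≤ 0 := not_lt.1 hω
        have h3 : 0 ≤ birkhoffMax T g n (T ω) := birkhoffMax_nonneg _ _
        simp only [Set.indicator_of_notMem hω]
        linarith
    have h2 : ∫ ω, birkhoffMax T g n (T ω) ∂μ = ∫ ω, birkhoffMax T g n ω ∂μ := by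
      conv_rhs => rw [← hT.map_eq]
      rw [integral_map hT.aemeasurable (by rw [hT.map_eq]; exact (hM n).aestronglyMeasurable)]
    have h3 : ∫ ω, birkhoffMax T g n ω ∂μ ≤ ∫ ω, birkhoffMax T g (n + 1) ω ∂μ :=
      integral_mono (hM n) (hM (n + 1)) (birkhoffMax_le_succ n)
    rw [integral_sub (hM (n + 1)) hMT, h2] at h1
    linarith
  refine ge_of_tendsto' (tendsto_integral_of_dominated_convergence (fun ω => |g ω|)
    (fun n => (hind n).aestronglyMeasurable) hg.abs (fun n => ?_) ?_) hnonneg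
  · filter_upwards with ω
    exact norm_indicator_le_norm_self _ _
  · filter_upwards [h] with ω ⟨n, hn⟩
    refine tendsto_const_nhds.congr' ?_
    filter_upwards [eventually_ge_atTop n] with k hk
    refine (Set.indicator_of_mem ?_ _).symm
    exact hn.trans_le ((birkhoffSum_le_birkhoffMax n ω).trans
      (birkhoffMax_monotone ω (by omega)))

/-- Zero-one law for the boundedness of a process whose decrease along orbits is bounded
uniformly in time. -/
lemma ae_bddAbove_or_ae_not_bddAbove [IsFiniteMeasure μ] (hT : Ergodic T μ) {f : ℕ → Ω → ℝ}
    (hf : ∀ n, AEMeasurable (f n) μ) (h : Ω → ℝ) (hsucc : ∀ n ω, f n (T ω) - h ω ≤ f (n + 1) ω) :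
    (∀ᵐ ω ∂μ, BddAbove (Set.range fun n => f n ω)) ∨
      ∀ᵐ ω ∂μ, ¬ BddAbove (Set.range fun n => f n ω) := by
  let A : Set Ω := {ω | ¬ BddAbove (Set.range fun n => f n ω)}
  have hA : A = (⋃ M : ℕ, ⋂ n, {ω | f n ω ≤ M})ᶜ := by
    ext ω
    simp only [A, Set.mem_ofPred_eq, Set.mem_compl_iff, Set.mem_iUnion, Set.mem_iInter, not_iff_not]
    constructor
    · rintro ⟨B, hB⟩
      obtain ⟨M, hM⟩ := exists_nat_ge B
      exact ⟨M, fun n => (hB ⟨n, rfl⟩).trans hM⟩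
    · rintro ⟨M, hM⟩
      exact ⟨M, by rintro _ ⟨n, rfl⟩; exact hM n⟩
  have hmeas : NullMeasurableSet A μ := by
    rw [hA]
    exact (NullMeasurableSet.iUnion fun M => NullMeasurableSet.iInter fun n =>
      nullMeasurableSet_le (hf n) aemeasurable_const).compl
  -- `hsucc` yields only an inclusion, not invariance; since `T` preserves the finite measure `μ`,
  -- ergodicity still makes `A` trivial.
  have hsub : T ⁻¹' A ⊆ A := by
    rintro ω hω ⟨B, hB⟩
    refine hω ⟨B + h ω, ?_⟩
    rintro _ ⟨n, rfl⟩
    have h1 : f (n + 1) ω ≤ B := hB ⟨n + 1, rfl⟩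
    have h2 := hsucc n ω
    simp only
    linarith
  rcases hT.ae_empty_or_univ_of_preimage_ae_le hmeas hsub.eventuallyLE with h | h
  · left
    filter_upwards [h.mem_iff] with ω hω
    by_contra hcon
    exact (hω.1 hcon).elim
  · right
    filter_upwards [h.mem_iff] with ω hω
    exact hω.2 trivial

lemma eventually_inv_mul_lt_of_bddAbove {a : ℕ → ℝ} {q r : ℝ}
    (h : BddAbove (Set.range fun n : ℕ => a n - n * q)) (hqr : q < r) :
    ∀ᶠ n : ℕ in atTop, (n : ℝ)⁻¹ * a n < r := by
  obtain ⟨B, hB⟩ := h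
  have h1 : Tendsto (fun n : ℕ => (n : ℝ) * (r - q)) atTop atTop :=
    tendsto_natCast_atTop_atTop.atTop_mul_const (sub_pos.2 hqr)
  filter_upwards [h1.eventually_gt_atTop B, eventually_gt_atTop 0] with n hn hn0
  have h2 : a n - n * q ≤ B := hB ⟨n, rfl⟩
  have hn0' : (0 : ℝ) < n := by exact_mod_cast hn0
  rw [inv_mul_lt_iff₀ hn0']
  nlinarith

lemma ae_forall_gt_eventually_inv_mul_lt {f : ℕ → Ω → ℝ} {L : ℝ}
    (h : ∀ q > L, ∀ᵐ ω ∂μ, BddAbove (Set.range fun n : ℕ => f n ω - n * q)) :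
    ∀ᵐ ω ∂μ, ∀ r > L, ∀ᶠ n : ℕ in atTop, (n : ℝ)⁻¹ * f n ω < r := by
  have h1 : ∀ᵐ ω ∂μ, ∀ k : ℕ,
      BddAbove (Set.range fun n : ℕ => f n ω - n * (L + 1 / ((k : ℝ) + 1))) :=
    ae_all_iff.2 fun k => h _ (lt_add_of_pos_right _ (by positivity))
  filter_upwards [h1] with ω hω r hr
  obtain ⟨k, hk⟩ := exists_nat_one_div_lt (sub_pos.2 hr)
  exact eventually_inv_mul_lt_of_bddAbove (hω k) (by linarith)

lemma integrable_birkhoffSum (hT : MeasurePreserving T μ μ) (hg : Integrable g μ) (n : ℕ) :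
    Integrable (birkhoffSum T g n) μ :=
  integrable_finsetSum _ fun k _ => (hT.iterate k).integrable_comp_of_integrable hg

lemma integral_comp_iterate (hT : MeasurePreserving T μ μ) (hg : Integrable g μ) (k : ℕ) :
    ∫ ω, g (T^[k] ω) ∂μ = ∫ ω, g ω ∂μ := by
  have h := hT.iterate k
  conv_rhs => rw [← h.map_eq]
  rw [integral_map h.aemeasurable (by rw [h.map_eq]; exact hg.aestronglyMeasurable)]

lemma integral_birkhoffSum (hT : MeasurePreserving T μ μ) (hg : Integrable g μ) (n : ℕ) :
    ∫ ω, birkhoffSum T g n ω ∂μ = n * ∫ ω, g ω ∂μ := by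
  simp only [birkhoffSum]
  rw [integral_finsetSum (f := fun k ω => g (T^[k] ω)) _ fun k _ =>
    (hT.iterate k).integrable_comp_of_integrable hg]
  simp [integral_comp_iterate hT hg]

/-- If the sums of `g - q` exceed every bound almost surely, then `q ≤ ∫ g`. -/
lemma le_integral_of_not_bddAbove [IsProbabilityMeasure μ] (hT : MeasurePreserving T μ μ)
    (hg : Integrable g μ) {q : ℝ}
    (h : ∀ᵐ ω ∂μ, ¬ BddAbove (Set.range fun n : ℕ => birkhoffSum T g n ω - n * q)) :
    q ≤ ∫ ω, g ω ∂μ := by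
  -- A sequence of sums with no positive term would be bounded above by 0.
  have h1 := integral_nonneg_of_exists_birkhoffSum_pos hT (hg.sub (integrable_const q)) (by
    filter_upwards [h] with ω hω
    by_contra! hcon
    refine hω ⟨0, ?_⟩
    rintro _ ⟨n, rfl⟩
    exact (birkhoffSum_sub_const q n ω).symm.trans_le (hcon n))
  rw [integral_sub' hg (integrable_const q)] at h1
  simpa using h1

lemma ae_forall_gt_eventually_birkhoffSum_lt [IsProbabilityMeasure μ] (hT : Ergodic T μ)
    (hg : Integrable g μ) :
    ∀ᵐ ω ∂μ, ∀ r > ∫ ω, g ω ∂μ, ∀ᶠ n : ℕ in atTop, (n : ℝ)⁻¹ * birkhoffSum T g n ω < r := by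
  refine ae_forall_gt_eventually_inv_mul_lt fun q hq => ?_
  refine (ae_bddAbove_or_ae_not_bddAbove hT
    (fun n => ((integrable_birkhoffSum hT.toMeasurePreserving hg n).sub
      (integrable_const (n * q))).aemeasurable) (fun ω => q - g ω) ?_).resolve_right ?_
  · intro n ω
    simp only [Pi.sub_apply, birkhoffSum_succ' T g n ω]
    push_cast
    linarith
  · intro h
    exact absurd (le_integral_of_not_bddAbove hT.toMeasurePreserving hg h) (not_le.2 hq)

/-- **Birkhoff's pointwise ergodic theorem** for an ergodic transformation. -/
theorem ae_tendsto_birkhoffSum [IsProbabilityMeasure μ] (hT : Ergodic T μ) (hg : Integrable g μ) :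
    ∀ᵐ ω ∂μ, Tendsto (fun n : ℕ => (n : ℝ)⁻¹ * birkhoffSum T g n ω) atTop (𝓝 (∫ ω, g ω ∂μ)) := by
  filter_upwards [ae_forall_gt_eventually_birkhoffSum_lt hT hg,
    ae_forall_gt_eventually_birkhoffSum_lt hT hg.neg] with ω h1 h2
  refine tendsto_order.2 ⟨fun r hr => ?_, h1⟩
  have h3 := h2 (-r) (by simp only [Pi.neg_apply, integral_neg]; linarith)
  filter_upwards [h3] with n hn
  rw [birkhoffSum_neg] at hn
  linarith

end Ergodic

/-! ### Continuous approximation of lower semicontinuous functions from below. -/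

section Regularization

variable {Z : Type*} [PseudoMetricSpace Z] {u : Z → ℝ} {B : ℝ}

/-- The Pasch–Hausdorff envelope of `u`: the largest `k`-Lipschitz minorant of `u`. -/
noncomputable def lipschitzEnvelope (u : Z → ℝ) (k : ℕ) (p : Z) : ℝ := ⨅ q, (u q + k * dist p q)

lemma bddBelow_lipschitzEnvelope (hB : ∀ p, B ≤ u p) (k : ℕ) (p : Z) :
    BddBelow (Set.range fun q => u q + k * dist p q) := by
  refine ⟨B, ?_⟩
  rintro _ ⟨q, rfl⟩
  have : 0 ≤ (k : ℝ) * dist p q := by positivity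
  linarith [hB q]

lemma lipschitzEnvelope_le (hB : ∀ p, B ≤ u p) (k : ℕ) (p q : Z) :
    lipschitzEnvelope u k p ≤ u q + k * dist p q :=
  ciInf_le (bddBelow_lipschitzEnvelope hB k p) q

lemma le_lipschitzEnvelope (hB : ∀ p, B ≤ u p) (k : ℕ) (p : Z) : B ≤ lipschitzEnvelope u k p := by
  have : Nonempty Z := ⟨p⟩
  refine le_ciInf fun q => ?_
  have : 0 ≤ (k : ℝ) * dist p q := by positivity
  linarith [hB q]

lemma lipschitzEnvelope_mono (hB : ∀ p, B ≤ u p) (p : Z) :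
    Monotone fun k => lipschitzEnvelope u k p := by
  intro k l hkl
  refine ciInf_mono (bddBelow_lipschitzEnvelope hB k p) fun q => ?_
  gcongr

lemma continuous_lipschitzEnvelope (hB : ∀ p, B ≤ u p) (k : ℕ) :
    Continuous (lipschitzEnvelope u k) := by
  refine (LipschitzWith.of_le_add_mul (k : NNReal) fun p p' => ?_).continuous
  have : Nonempty Z := ⟨p⟩
  rw [← sub_le_iff_le_add]
  refine le_ciInf fun q => ?_
  have h1 := lipschitzEnvelope_le hB k p q
  have h2 : (k : ℝ) * dist p q ≤ k * dist p p' + k * dist p' q := by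
    rw [← mul_add]
    gcongr
    exact dist_triangle _ _ _
  simp only [NNReal.coe_natCast]
  linarith

/-- Near `p` semicontinuity keeps `u` above `a`; at distance at least `δ` the penalty `k * δ`
eventually outweighs the lower bound `B`. -/
lemma eventually_le_lipschitzEnvelope (hu : LowerSemicontinuous u) (hB : ∀ p, B ≤ u p) (p : Z)
    {a : ℝ} (ha : a < u p) : ∀ᶠ k in atTop, a ≤ lipschitzEnvelope u k p := by
  have : Nonempty Z := ⟨p⟩
  obtain ⟨δ, hδ, hball⟩ := Metric.eventually_nhds_iff.1 (hu p a ha)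
  have h1 : Tendsto (fun k : ℕ => (k : ℝ) * δ) atTop atTop :=
    tendsto_natCast_atTop_atTop.atTop_mul_const hδ
  filter_upwards [h1.eventually_ge_atTop (a - B)] with k hk
  refine le_ciInf fun q => ?_
  by_cases hq : dist q p < δ
  · have : 0 ≤ (k : ℝ) * dist p q := by positivity
    linarith [hball hq]
  · have : (k : ℝ) * δ ≤ k * dist p q := by
      rw [dist_comm]
      gcongr
      exact not_lt.1 hq
    linarith [hB q]

end Regularization

/-- A lower semicontinuous function that is bounded below is the limit of an increasing sequence of
bounded continuous functions. -/
lemma exists_monotone_boundedContinuous_tendsto {Z : Type*} [TopologicalSpace Z]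
    [TopologicalSpace.PseudoMetrizableSpace Z] {u : Z → ℝ} (hu : LowerSemicontinuous u) {B : ℝ}
    (hB : ∀ p, B ≤ u p) :
    ∃ φ : ℕ → BoundedContinuousFunction Z ℝ, (∀ p, Monotone fun k => φ k p) ∧
      (∀ k p, min B 0 ≤ φ k p) ∧ (∀ k p, φ k p ≤ u p) ∧
      ∀ p, Tendsto (fun k => φ k p) atTop (𝓝 (u p)) := by
  let _ := TopologicalSpace.pseudoMetrizableSpacePseudoMetric Z
  have hlow (k : ℕ) (p : Z) : min B 0 ≤ min (k : ℝ) (lipschitzEnvelope u k p) :=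
    le_min ((min_le_right _ _).trans k.cast_nonneg)
      ((min_le_left _ _).trans (le_lipschitzEnvelope hB k p))
  have hup (k : ℕ) (p : Z) : min (k : ℝ) (lipschitzEnvelope u k p) ≤ u p :=
    (min_le_right _ _).trans (by simpa using lipschitzEnvelope_le hB k p p)
  refine ⟨fun k => BoundedContinuousFunction.ofNormedAddCommGroup
    (fun p => min (k : ℝ) (lipschitzEnvelope u k p))
    (continuous_const.min (continuous_lipschitzEnvelope hB k)) (max k (-(min B 0))) fun p => ?_,
    fun p k l hkl => min_le_min (by exact_mod_cast hkl) (lipschitzEnvelope_mono hB p hkl),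
    hlow, hup, fun p => tendsto_order.2 ⟨fun a ha => ?_, fun a ha => ?_⟩⟩
  · rw [Real.norm_eq_abs, abs_le]
    constructor
    · linarith [hlow k p, le_max_right (k : ℝ) (-(min B 0))]
    · exact (min_le_left _ _).trans (le_max_left _ _)
  · obtain ⟨b, hab, hb⟩ := exists_between ha
    filter_upwards [eventually_le_lipschitzEnvelope hu hB p hb,
      tendsto_natCast_atTop_atTop.eventually_ge_atTop b] with k h1 h2
    exact hab.trans_le (le_min h2 h1)
  · exact Eventually.of_forall fun k => (hup k p).trans_lt ha

/-! ### Minimal tracking costs: block estimates and measurability. -/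

section MinSum

variable {X Y : Type*} {S : X → X} {T : Y → Y} {c : X × Y → ℝ} {h : Y → ℝ}

/-- The minimal cost `inf_x ∑_{k < n} c (S^k x, T^k y)` of tracking the orbit of `y`. -/
noncomputable def minSum (S : X → X) (T : Y → Y) (c : X × Y → ℝ) (n : ℕ) (y : Y) : ℝ :=
  ⨅ x, birkhoffSum (Prod.map S T) c n (x, y)

lemma birkhoffSum_prodMap (n : ℕ) (x : X) (y : Y) :
    birkhoffSum (Prod.map S T) c n (x, y) = ∑ k ∈ Finset.range n, c (S^[k] x, T^[k] y) := by
  simp [birkhoffSum, Prod.map_iterate]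

lemma abs_birkhoffSum_prodMap_le (hc : ∀ x y, |c (x, y)| ≤ h y) (n : ℕ) (x : X) (y : Y) :
    |birkhoffSum (Prod.map S T) c n (x, y)| ≤ birkhoffSum T h n y := by
  rw [birkhoffSum_prodMap]
  exact (Finset.abs_sum_le_sum_abs _ _).trans (Finset.sum_le_sum fun k _ => hc _ _)

lemma minSum_le (hc : ∀ x y, |c (x, y)| ≤ h y) (n : ℕ) (x : X) (y : Y) :
    minSum S T c n y ≤ birkhoffSum (Prod.map S T) c n (x, y) := by
  refine ciInf_le ⟨-birkhoffSum T h n y, ?_⟩ x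
  rintro _ ⟨x', rfl⟩
  exact (abs_le.1 (abs_birkhoffSum_prodMap_le hc n x' y)).1

lemma abs_minSum_le [Nonempty X] (hc : ∀ x y, |c (x, y)| ≤ h y) (n : ℕ) (y : Y) :
    |minSum S T c n y| ≤ birkhoffSum T h n y := by
  obtain ⟨x⟩ := ‹Nonempty X›
  have : Nonempty X := ⟨x⟩
  refine abs_le.2 ⟨le_ciInf fun x' => (abs_le.1 (abs_birkhoffSum_prodMap_le hc n x' y)).1, ?_⟩
  exact (minSum_le hc n x y).trans (abs_le.1 (abs_birkhoffSum_prodMap_le hc n x y)).2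

/-- After one step `x` becomes `S x`, one competitor for `T y`. This is the hypothesis of the
zero-one law. -/
lemma minSum_sub_le_minSum_succ [Nonempty X] (hc : ∀ x y, |c (x, y)| ≤ h y) (n : ℕ) (y : Y) :
    minSum S T c n (T y) - h y ≤ minSum S T c (n + 1) y := by
  refine le_ciInf fun x => ?_
  rw [birkhoffSum_succ', Prod.map_apply]
  linarith [minSum_le hc n (S x) (T y) (S := S) (T := T), (abs_le.1 (hc x y)).1]

/-- Exchanging the two sums leaves `m` shifted windows of length `n`, each inside the window of
length `n + m`; nonnegativity absorbs the ends. -/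
lemma birkhoffSum_birkhoffSum_le {Z : Type*} {R : Z → Z} {b : Z → ℝ} (hb : ∀ p, 0 ≤ b p) (m n : ℕ)
    (p : Z) : birkhoffSum R (birkhoffSum R b m) n p ≤ m * birkhoffSum R b (n + m) p := by
  have h1 : birkhoffSum R (birkhoffSum R b m) n p
      = ∑ i ∈ Finset.range m, birkhoffSum R b n (R^[i] p) := by
    simp only [birkhoffSum]
    rw [Finset.sum_comm]
    simp only [← Function.iterate_add_apply, add_comm]
  rw [h1]
  calc ∑ i ∈ Finset.range m, birkhoffSum R b n (R^[i] p)
      ≤ ∑ i ∈ Finset.range m, birkhoffSum R b (n + m) p := by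
        refine Finset.sum_le_sum fun i hi => ?_
        have h2 : birkhoffSum R b (i + n) p ≤ birkhoffSum R b (n + m) p :=
          Finset.sum_le_sum_of_subset_of_nonneg
            (Finset.range_mono (by have := Finset.mem_range.1 hi; omega)) fun k _ _ => hb _
        have h3 : 0 ≤ birkhoffSum R b i p := Finset.sum_nonneg fun k _ => hb _
        rw [birkhoffSum_add] at h2
        linarith
    _ = m * birkhoffSum R b (n + m) p := by simp

/-- Every block of length `m` along an orbit costs at least the minimal cost from its starting
point. Adding `h` makes the cost nonnegative, so blocks can be counted at all offsets. -/
lemma birkhoffSum_minSum_le [Nonempty X] (hc : ∀ x y, |c (x, y)| ≤ h y) {m : ℕ} (hm : 0 < m)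
    (n : ℕ) (y : Y) :
    (m : ℝ)⁻¹ * (birkhoffSum T (minSum S T c m) n y + birkhoffSum T (birkhoffSum T h m) n y)
      - birkhoffSum T h (n + m) y ≤ minSum S T c (n + m) y := by
  refine le_ciInf fun x => ?_
  let b : X × Y → ℝ := fun p => c p + h p.2
  have hb : ∀ p, 0 ≤ b p := fun p => by
    have := (abs_le.1 (hc p.1 p.2)).1
    change 0 ≤ c (p.1, p.2) + h p.2
    linarith
  have hbsum (k : ℕ) (p : X × Y) : birkhoffSum (Prod.map S T) b k p
      = birkhoffSum (Prod.map S T) c k p + birkhoffSum T h k p.2 := by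
    simp [birkhoffSum, b, Prod.map_iterate, Finset.sum_add_distrib]
  have h1 := birkhoffSum_birkhoffSum_le (R := Prod.map S T) hb m n (x, y)
  rw [hbsum] at h1
  have h2 : birkhoffSum T (minSum S T c m) n y + birkhoffSum T (birkhoffSum T h m) n y
      ≤ birkhoffSum (Prod.map S T) (birkhoffSum (Prod.map S T) b m) n (x, y) := by
    rw [birkhoffSum_prodMap, birkhoffSum, birkhoffSum, ← Finset.sum_add_distrib]
    refine Finset.sum_le_sum fun k _ => ?_
    rw [hbsum]
    gcongr
    exact minSum_le hc _ _ _
  have hm' : (0 : ℝ) < m := by exact_mod_cast hm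
  rw [sub_le_iff_le_add, inv_mul_le_iff₀ hm']
  exact h2.trans h1

/-- The infimum of a lower semicontinuous function along a compact space is lower semicontinuous. -/
lemma lowerSemicontinuous_iInf_of_compact {V : Type*} [TopologicalSpace V] [TopologicalSpace X]
    [CompactSpace X] [Nonempty X] {F : X × V → ℝ} (hF : LowerSemicontinuous F) :
    LowerSemicontinuous fun v => ⨅ x, F (x, v) := by
  intro v a ha
  obtain ⟨b, hab, hb⟩ := exists_between ha
  have hbdd : BddBelow (Set.range fun x => F (x, v)) := by
    have h1 : LowerSemicontinuous fun x => F (x, v) :=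
      hF.comp (continuous_id.prodMk continuous_const)
    simpa using (h1.lowerSemicontinuousOn Set.univ).bddBelow_of_isCompact isCompact_univ
  have h2 : ∀ᶠ w in 𝓝 v, ∀ x ∈ (Set.univ : Set X), b < F (x, w) := by
    refine isCompact_univ.eventually_forall_of_forall_eventually fun x _ => ?_
    have h3 := hF (x, v) b (hb.trans_le (ciInf_le hbdd x))
    exact (continuous_swap.tendsto (v, x)).eventually h3
  filter_upwards [h2] with w hw
  exact hab.trans_le (le_ciInf fun x => (hw x trivial).le)

lemma measurable_minSum [TopologicalSpace X] [CompactSpace X] [Nonempty X] [TopologicalSpace Y]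
    [SecondCountableTopology Y] [MeasurableSpace Y] [BorelSpace Y] (hS : Continuous S)
    (hT : Measurable T) (hc : LowerSemicontinuous c) (n : ℕ) : Measurable (minSum S T c n) := by
  -- As `T` is only measurable, the cost sum need not be semicontinuous in `y`. Treating the orbit
  -- of `y` as a free vector restores semicontinuity; `T` enters only through a measurable
  -- substitution.
  let F : X × (Fin n → Y) → ℝ := fun p => ∑ k : Fin n, c (S^[k] p.1, p.2 k)
  have hF : LowerSemicontinuous F := lowerSemicontinuous_sum fun k _ =>
    hc.comp (((hS.iterate k).comp continuous_fst).prodMk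
      ((continuous_apply k).comp continuous_snd))
  have h1 := (lowerSemicontinuous_iInf_of_compact hF).measurable
  have h2 : Measurable fun y => fun k : Fin n => T^[k] y :=
    measurable_pi_lambda _ fun k => hT.iterate k
  have h3 : minSum S T c n = (fun v => ⨅ x, F (x, v)) ∘ fun y => fun k : Fin n => T^[k] y := by
    ext y
    simp only [minSum, birkhoffSum_prodMap, Function.comp, F]
    congr 1 with x
    exact (Fin.sum_univ_eq_sum_range (fun k => c (S^[k] x, T^[k] y)) n).symm
  rw [h3]
  exact h1.comp h2

end MinSum

/-! ### Almost sure lower and upper bounds for the average minimal cost. -/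

section Convergence

variable {X Y : Type*} [MeasurableSpace Y] {S : X → X} {T : Y → Y} {ν : Measure Y}
  {c : X × Y → ℝ} {h : Y → ℝ}

lemma integrable_minSum [Nonempty X] (hT : MeasurePreserving T ν ν) (hh : Integrable h ν)
    (hc : ∀ x y, |c (x, y)| ≤ h y) {n : ℕ} (hmeas : Measurable (minSum S T c n)) :
    Integrable (minSum S T c n) ν :=
  (integrable_birkhoffSum hT hh n).mono' hmeas.aestronglyMeasurable
    (Eventually.of_forall fun y => abs_minSum_le hc n y)

lemma ae_forall_lt_eventually_lt_minSum [Nonempty X] [IsProbabilityMeasure ν] (hT : Ergodic T ν)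
    (hh : Integrable h ν) (hc : ∀ x y, |c (x, y)| ≤ h y) {m : ℕ} (hm : 0 < m)
    (hmeas : Measurable (minSum S T c m)) :
    ∀ᵐ y ∂ν, ∀ r < (m : ℝ)⁻¹ * ∫ y, minSum S T c m y ∂ν,
      ∀ᶠ n : ℕ in atTop, r < (n : ℝ)⁻¹ * minSum S T c n y := by
  have hmp := hT.toMeasurePreserving
  have hm' : (m : ℝ) ≠ 0 := by exact_mod_cast hm.ne'
  filter_upwards [ae_tendsto_birkhoffSum hT (integrable_minSum hmp hh hc hmeas),
    ae_tendsto_birkhoffSum hT (integrable_birkhoffSum hmp hh m),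
    ae_tendsto_birkhoffSum hT hh] with y h1 h2 h3 r hr
  rw [integral_birkhoffSum hmp hh] at h2
  have h4 : Tendsto (fun n : ℕ => (n : ℝ) / ((n : ℝ) + m)) atTop (𝓝 1) :=
    tendsto_natCast_div_add_atTop (m : ℝ)
  -- Limit of the block bound divided by `n + m`; the two contributions of `∫ h` cancel in `h6`.
  have h5 := (h4.mul ((h1.add h2).const_mul (m : ℝ)⁻¹)).sub (h3.comp (tendsto_add_atTop_nat m))
  have h6 : 1 * ((m : ℝ)⁻¹ * (∫ y, minSum S T c m y ∂ν + m * ∫ y, h y ∂ν)) - ∫ y, h y ∂ν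
      = (m : ℝ)⁻¹ * ∫ y, minSum S T c m y ∂ν := by
    field_simp
    ring
  rw [h6] at h5
  rw [← map_add_atTop_eq_nat m, eventually_map]
  filter_upwards [h5.eventually (lt_mem_nhds hr), eventually_gt_atTop 0] with n hn hn0
  have hn' : (0 : ℝ) < n := by exact_mod_cast hn0
  have h7 := birkhoffSum_minSum_le (S := S) (T := T) hc hm n y
  refine hn.trans_le ?_
  calc _ = ((n + m : ℕ) : ℝ)⁻¹ * ((m : ℝ)⁻¹ * (birkhoffSum T (minSum S T c m) n y
          + birkhoffSum T (birkhoffSum T h m) n y) - birkhoffSum T h (n + m) y) := by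
        simp only [Function.comp]
        push_cast
        field_simp
    _ ≤ _ := by gcongr

variable [MeasurableSpace X]

lemma ae_forall_gt_eventually_minSum_lt [Nonempty X] [IsProbabilityMeasure ν] (hT : Ergodic T ν)
    (hc : ∀ x y, |c (x, y)| ≤ h y)
    (hmeas : ∀ n, Measurable (minSum S T c n)) {lam : Measure (X × Y)} [IsProbabilityMeasure lam]
    (hlam : MeasurePreserving (Prod.map S T) lam lam) (hsnd : lam.map Prod.snd = ν)
    (hint : Integrable c lam) :
    ∀ᵐ y ∂ν, ∀ r > ∫ p, c p ∂lam, ∀ᶠ n : ℕ in atTop, (n : ℝ)⁻¹ * minSum S T c n y < r := by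
  refine ae_forall_gt_eventually_inv_mul_lt fun q hq => ?_
  refine (ae_bddAbove_or_ae_not_bddAbove hT (fun n => ((hmeas n).sub_const _).aemeasurable)
    (fun y => q + h y) ?_).resolve_right fun hcon => not_le.2 hq ?_
  · intro n y
    have := minSum_sub_le_minSum_succ hc n y (S := S) (T := T)
    push_cast
    linarith
  · refine le_integral_of_not_bddAbove hlam hint ?_
    rw [← hsnd] at hcon
    -- Unboundedness for ν-a.e. `y` lifts through the marginal to λ-a.e. `p`, where the cost sums
    -- dominate `minSum`.
    filter_upwards [ae_of_ae_map measurable_snd.aemeasurable hcon] with p hp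
    rintro ⟨B, hB⟩
    refine hp ⟨B, ?_⟩
    rintro _ ⟨n, rfl⟩
    have h1 : birkhoffSum (Prod.map S T) c n p - n * q ≤ B := hB ⟨n, rfl⟩
    have h2 := minSum_le hc n p.1 p.2 (S := S) (T := T)
    simp only
    linarith

lemma integral_minSum_le [Nonempty X] (hT : MeasurePreserving T ν ν)
    (hh : Integrable h ν) (hc : ∀ x y, |c (x, y)| ≤ h y) {n : ℕ}
    (hmeas : Measurable (minSum S T c n)) {lam : Measure (X × Y)}
    (hlam : MeasurePreserving (Prod.map S T) lam lam) (hsnd : lam.map Prod.snd = ν)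
    (hint : Integrable c lam) : ∫ y, minSum S T c n y ∂ν ≤ n * ∫ p, c p ∂lam := by
  rw [← integral_birkhoffSum hlam hint]
  have h1 := integrable_minSum hT hh hc hmeas
  rw [← hsnd] at h1 ⊢
  rw [integral_map measurable_snd.aemeasurable h1.aestronglyMeasurable]
  exact integral_mono (h1.comp_measurable measurable_snd) (integrable_birkhoffSum hlam hint n)
    fun p => minSum_le hc n p.1 p.2

end Convergence

/-! ### Weak limits of measures with a fixed second marginal. -/

section Compactness

variable {X Y : Type*} [TopologicalSpace X] [CompactSpace X] [TopologicalSpace.MetrizableSpace X]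
  [MeasurableSpace X] [BorelSpace X] [TopologicalSpace Y] [PolishSpace Y] [MeasurableSpace Y]
  [BorelSpace Y] {S : X → X} {T : Y → Y} {ν : Measure Y}

omit [TopologicalSpace.MetrizableSpace X] [BorelSpace X] in
/-- Measures on `X × Y` with a fixed second marginal form a tight set when `X` is compact. -/
lemma isTightMeasureSet_map_snd_eq [IsProbabilityMeasure ν] :
    IsTightMeasureSet {lam : Measure (X × Y) | lam.map Prod.snd = ν} := by
  have h := isTightMeasureSet_singleton (μ := ν)
  rw [isTightMeasureSet_iff_exists_isCompact_measure_compl_le] at h ⊢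
  intro ε hε
  obtain ⟨K, hK, hKε⟩ := h ε hε
  refine ⟨Set.univ ×ˢ K, isCompact_univ.prod hK, fun lam hlam => ?_⟩
  have h1 : (Set.univ ×ˢ K : Set (X × Y))ᶜ = Prod.snd ⁻¹' Kᶜ := by
    ext p
    simp
  rw [h1, ← Measure.map_apply measurable_snd hK.measurableSet.compl]
  exact hKε _ hlam

/-- Tightness gives relative compactness by Prokhorov; a nonprincipal ultrafilter takes the place of
a convergent subsequence. -/
lemma exists_tendsto_probabilityMeasure [IsProbabilityMeasure ν]
    {lam : ℕ → ProbabilityMeasure (X × Y)}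
    (hlam : ∀ n, (lam n : Measure (X × Y)).map Prod.snd = ν) :
    ∃ (F : Filter ℕ) (l : ProbabilityMeasure (X × Y)), F.NeBot ∧ F ≤ atTop ∧
      Tendsto lam F (𝓝 l) := by
  have h1 : IsCompact (closure {l : ProbabilityMeasure (X × Y) |
      (l : Measure (X × Y)).map Prod.snd = ν}) := by
    refine isCompact_closure_of_isTightMeasureSet
      ((isTightMeasureSet_map_snd_eq (X := X) (ν := ν)).subset ?_)
    rintro _ ⟨l, hl, rfl⟩
    exact hl
  obtain ⟨l, -, hl⟩ := h1.ultrafilter_le_nhds ((hyperfilter ℕ).map lam) (by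
    rw [le_principal_iff]
    exact Eventually.of_forall (f := (hyperfilter ℕ : Filter ℕ)) fun n => subset_closure (hlam n))
  exact ⟨hyperfilter ℕ, l, inferInstance, Nat.hyperfilter_le_atTop, hl⟩

variable {F : Filter ℕ} [F.NeBot] {lam : ℕ → ProbabilityMeasure (X × Y)}
  {l : ProbabilityMeasure (X × Y)}

omit [CompactSpace X] [TopologicalSpace.MetrizableSpace X] in
lemma map_snd_eq_of_tendsto [IsProbabilityMeasure ν] (hl : Tendsto lam F (𝓝 l))
    (hlam : ∀ n, (lam n : Measure (X × Y)).map Prod.snd = ν) :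
    (l : Measure (X × Y)).map Prod.snd = ν := by
  have h1 := ((ProbabilityMeasure.continuous_map (Ω := X × Y) continuous_snd).tendsto l).comp hl
  let ν' : ProbabilityMeasure Y := ⟨ν, inferInstance⟩
  have h2 : ∀ n, (lam n).map continuous_snd.measurable.aemeasurable = ν' :=
    fun n => Subtype.ext (hlam n)
  have h3 : Tendsto (fun _ : ℕ => ν') F (𝓝 (l.map continuous_snd.measurable.aemeasurable)) :=
    h1.congr h2
  have h4 := tendsto_nhds_unique h3 tendsto_const_nhds
  exact congrArg (fun m : ProbabilityMeasure Y => (m : Measure Y)) h4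

omit [CompactSpace X] [TopologicalSpace.MetrizableSpace X] in
lemma integrable_mul_of_map_snd_eq {κ : Measure (X × Y)} (hκ : κ.map Prod.snd = ν)
    (f : BoundedContinuousFunction X ℝ) {g : Y → ℝ} (hg : Integrable g ν) :
    Integrable (fun p : X × Y => f p.1 * g p.2) κ := by
  rw [← hκ] at hg
  exact (hg.comp_measurable measurable_snd).bdd_mul (c := ‖f‖)
    (f.continuous.comp continuous_fst).aestronglyMeasurable
    (Eventually.of_forall fun p => f.norm_coe_le_norm p.1)

-- The bound depends on `κ` only through `ν`, so approximating `g` in L¹(ν) is uniform over all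
-- measures with this marginal.
omit [CompactSpace X] [TopologicalSpace.MetrizableSpace X] in
lemma abs_integral_mul_sub_le {κ : Measure (X × Y)} (hκ : κ.map Prod.snd = ν)
    (f : BoundedContinuousFunction X ℝ) {g g' : Y → ℝ} (hg : Integrable g ν)
    (hg' : Integrable g' ν) :
    |∫ p, f p.1 * g p.2 ∂κ - ∫ p, f p.1 * g' p.2 ∂κ| ≤ ‖f‖ * ∫ y, ‖g y - g' y‖ ∂ν := by
  rw [← integral_sub (integrable_mul_of_map_snd_eq hκ f hg)
    (integrable_mul_of_map_snd_eq hκ f hg')]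
  have h1 : Integrable (fun y => ‖f‖ * ‖g y - g' y‖) ν := (hg.sub hg').norm.const_mul _
  rw [← integral_const_mul]
  rw [← hκ] at h1 ⊢
  rw [integral_map measurable_snd.aemeasurable h1.aestronglyMeasurable]
  refine (abs_integral_le_integral_abs).trans (integral_mono_of_nonneg
    (Eventually.of_forall fun p => abs_nonneg _) (h1.comp_measurable measurable_snd)
    (Eventually.of_forall fun p => ?_))
  simp only [← mul_sub, abs_mul]
  exact mul_le_mul_of_nonneg_right (f.norm_coe_le_norm p.1) (abs_nonneg _)

omit [CompactSpace X] [TopologicalSpace.MetrizableSpace X] in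
/-- For a fixed second marginal, weak convergence also tests against products of a continuous
function on the first and an integrable function on the second factor. -/
lemma tendsto_integral_mul [IsProbabilityMeasure ν] (hl : Tendsto lam F (𝓝 l))
    (hlam : ∀ n, (lam n : Measure (X × Y)).map Prod.snd = ν) (f : BoundedContinuousFunction X ℝ)
    {g : Y → ℝ} (hg : Integrable g ν) :
    Tendsto (fun n => ∫ p, f p.1 * g p.2 ∂(lam n : Measure (X × Y))) F
      (𝓝 (∫ p, f p.1 * g p.2 ∂(l : Measure (X × Y)))) := by
  rw [Metric.tendsto_nhds]
  intro ε hε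
  -- The `+ 1` covers the case `‖f‖ = 0`.
  have hδ : 0 < ε / (3 * (‖f‖ + 1)) := by positivity
  have hδ' : ‖f‖ * (ε / (3 * (‖f‖ + 1))) < ε / 3 := by
    have := norm_nonneg f
    rw [mul_div_assoc', div_lt_div_iff₀ (by positivity) (by positivity)]
    nlinarith
  obtain ⟨g', hg'1, hg'2⟩ := hg.exists_boundedContinuous_integral_sub_le hδ
  have hle {κ : Measure (X × Y)} (hκ : κ.map Prod.snd = ν) :
      |∫ p, f p.1 * g p.2 ∂κ - ∫ p, f p.1 * g' p.2 ∂κ| < ε / 3 :=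
    (abs_integral_mul_sub_le hκ f hg hg'2).trans_lt
      ((mul_le_mul_of_nonneg_left hg'1 (norm_nonneg f)).trans_lt hδ')
  have h1 := ProbabilityMeasure.tendsto_iff_forall_integral_tendsto.1 hl
    (f.compContinuous ⟨Prod.fst, continuous_fst⟩ * g'.compContinuous ⟨Prod.snd, continuous_snd⟩)
  filter_upwards [Metric.tendsto_nhds.1 h1 (ε / 3) (by positivity)] with n hn
  rw [Real.dist_eq] at hn ⊢
  simp only [BoundedContinuousFunction.coe_mul, Pi.mul_apply,
    BoundedContinuousFunction.compContinuous_apply, ContinuousMap.coe_mk] at hn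
  have h2 := hle (hlam n)
  have h3 := hle (map_snd_eq_of_tendsto hl hlam)
  rw [abs_lt] at *
  constructor <;> linarith

omit [CompactSpace X] [TopologicalSpace Y] [PolishSpace Y] [BorelSpace Y] in
/-- Finite measures on a product are equal if they have the same integrals of products of a bounded
continuous function and an indicator. -/
lemma measure_prod_ext {κ κ' : Measure (X × Y)} [IsFiniteMeasure κ] [IsFiniteMeasure κ']
    (h : ∀ (f : BoundedContinuousFunction X ℝ) (B : Set Y), MeasurableSet B →
      ∫ p, f p.1 * B.indicator 1 p.2 ∂κ = ∫ p, f p.1 * B.indicator 1 p.2 ∂κ') : κ = κ' := by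
  refine Measure.ext_prod fun {A B} hA hB => ?_
  have hint (ρ : Measure (X × Y)) (f : BoundedContinuousFunction X ℝ) :
      ∫ x, f x ∂((ρ.restrict (Prod.snd ⁻¹' B)).map Prod.fst)
        = ∫ p, f p.1 * B.indicator 1 p.2 ∂ρ := by
    rw [integral_map measurable_fst.aemeasurable f.continuous.aestronglyMeasurable,
      ← integral_indicator (measurable_snd hB)]
    congr 1 with p
    by_cases hp : p.2 ∈ B
    · simp [hp]
    · simp [hp]
  have h1 : (κ.restrict (Prod.snd ⁻¹' B)).map Prod.fst
      = (κ'.restrict (Prod.snd ⁻¹' B)).map Prod.fst :=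
    ext_of_forall_integral_eq_of_IsFiniteMeasure fun f => by rw [hint, hint, h f B hB]
  have h2 := congrArg (fun ρ => ρ A) h1
  simpa only [Measure.map_apply measurable_fst hA, Measure.restrict_apply (measurable_fst hA),
    ← Set.prod_eq] using h2

omit [CompactSpace X] in
/-- A weak limit of asymptotically invariant measures with fixed second marginal is invariant, even
though `T` need not be continuous. -/
lemma measurePreserving_of_tendsto [IsProbabilityMeasure ν] (hS : Continuous S)
    (hT : MeasurePreserving T ν ν) (hl : Tendsto lam F (𝓝 l))
    (hlam : ∀ n, (lam n : Measure (X × Y)).map Prod.snd = ν)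
    (hinv : ∀ (ψ : X × Y → ℝ), Measurable ψ → (∃ C, ∀ p, |ψ p| ≤ C) →
      Tendsto (fun n => ∫ p, ψ (Prod.map S T p) ∂(lam n : Measure (X × Y))
        - ∫ p, ψ p ∂(lam n : Measure (X × Y))) F (𝓝 0)) :
    MeasurePreserving (Prod.map S T) (l : Measure (X × Y)) (l : Measure (X × Y)) := by
  have hR : Measurable (Prod.map S T) := hS.measurable.prodMap hT.measurable
  have hRl : IsProbabilityMeasure ((l : Measure (X × Y)).map (Prod.map S T)) :=
    Measure.isProbabilityMeasure_map hR.aemeasurable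
  refine ⟨hR, measure_prod_ext fun f B hB => ?_⟩
  have hind : Measurable (B.indicator (1 : Y → ℝ)) := measurable_one.indicator hB
  have hψ : Measurable fun p : X × Y => f p.1 * B.indicator 1 p.2 :=
    (f.continuous.measurable.comp measurable_fst).mul (hind.comp measurable_snd)
  rw [integral_map hR.aemeasurable hψ.aestronglyMeasurable]
  have hindi : Integrable (B.indicator (1 : Y → ℝ)) ν :=
    (integrable_const (1 : ℝ)).indicator hB
  -- Composition with `S × T` keeps the product form: `f ∘ S` is continuous, and the indicator
  -- composed with `T` need only be integrable.
  have h1 := tendsto_integral_mul hl hlam (f.compContinuous ⟨S, hS⟩)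
    (hT.integrable_comp_of_integrable hindi)
  have h2 := tendsto_integral_mul hl hlam f hindi
  have h3 := hinv _ hψ ⟨‖f‖, fun p => by
    rw [abs_mul]
    refine (mul_le_of_le_one_right (abs_nonneg _) ?_).trans (f.norm_coe_le_norm p.1)
    by_cases hp : p.2 ∈ B <;> simp [hp]⟩
  exact sub_eq_zero.1 (tendsto_nhds_unique (h1.sub h2) h3)

omit [CompactSpace X] [TopologicalSpace.MetrizableSpace X] in
/-- Semicontinuity of the integral under weak convergence, in terms of a continuous approximation
of the integrand. -/
lemma integral_le_of_tendsto {u : X × Y → ℝ} {B : ℝ}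
    {φ : ℕ → BoundedContinuousFunction (X × Y) ℝ} (hlow : ∀ k p, B ≤ φ k p)
    (hup : ∀ k p, φ k p ≤ u p) (hlim : ∀ p, Tendsto (fun k => φ k p) atTop (𝓝 (u p)))
    (hl : Tendsto lam F (𝓝 l)) (hu : Integrable u (l : Measure (X × Y))) {a : ℕ → ℝ} {L : ℝ}
    (ha : Tendsto a F (𝓝 L))
    (hφ : ∀ k, ∀ᶠ n in F, ∫ p, φ k p ∂(lam n : Measure (X × Y)) ≤ a n) :
    ∫ p, u p ∂(l : Measure (X × Y)) ≤ L := by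
  have h1 (k : ℕ) : ∫ p, φ k p ∂(l : Measure (X × Y)) ≤ L :=
    le_of_tendsto_of_tendsto (ProbabilityMeasure.tendsto_iff_forall_integral_tendsto.1 hl (φ k)) ha
      (hφ k)
  refine le_of_tendsto' (tendsto_integral_of_dominated_convergence (fun p => |u p| + |B|)
    (fun k => (φ k).continuous.aestronglyMeasurable) (hu.abs.add (integrable_const _))
    (fun k => Eventually.of_forall fun p => ?_) (Eventually.of_forall hlim)) h1
  rw [Real.norm_eq_abs, abs_le]
  constructor
  · linarith [hlow k p, neg_abs_le B, abs_nonneg (u p)]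
  · linarith [hup k p, le_abs_self (u p), abs_nonneg B]

end Compactness

/-! ### Averages of a measure along an orbit. -/

section Empirical

variable {Z : Type*} [MeasurableSpace Z] {R : Z → Z} {κ : Measure Z}

/-- The average of the first `n` images of `κ` under iteration of `R`. -/
noncomputable def averagedMeasure (R : Z → Z) (κ : Measure Z) (n : ℕ) : Measure Z :=
  (n : ENNReal)⁻¹ • ∑ k ∈ Finset.range n, κ.map R^[k]

lemma inv_smul_sum_range_const {n : ℕ} (hn : 0 < n) (ρ : Measure Z) :
    (n : ENNReal)⁻¹ • ∑ _k ∈ Finset.range n, ρ = ρ := by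
  rw [Finset.sum_const, Finset.card_range, ← Nat.cast_smul_eq_nsmul ENNReal, smul_smul,
    ENNReal.inv_mul_cancel (by exact_mod_cast hn.ne') (ENNReal.natCast_ne_top n), one_smul]

lemma isProbabilityMeasure_averagedMeasure [IsProbabilityMeasure κ] (hR : Measurable R) {n : ℕ}
    (hn : 0 < n) : IsProbabilityMeasure (averagedMeasure R κ n) := by
  constructor
  simp only [averagedMeasure, Measure.smul_apply, Measure.coe_finsetSum, Finset.sum_apply]
  simp only [Measure.map_apply (hR.iterate _) MeasurableSet.univ, Set.preimage_univ, measure_univ]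
  simp only [Finset.sum_const, Finset.card_range, nsmul_eq_mul, mul_one, smul_eq_mul]
  exact ENNReal.inv_mul_cancel (by exact_mod_cast hn.ne') (ENNReal.natCast_ne_top n)

lemma integrable_of_abs_le [IsFiniteMeasure κ] {ψ : Z → ℝ} (hψ : Measurable ψ) {C : ℝ}
    (hC : ∀ p, |ψ p| ≤ C) : Integrable ψ κ :=
  (integrable_const C).mono' hψ.aestronglyMeasurable (Eventually.of_forall hC)

lemma integral_averagedMeasure [IsFiniteMeasure κ] (hR : Measurable R) {ψ : Z → ℝ}
    (hψ : Measurable ψ) {C : ℝ} (hC : ∀ p, |ψ p| ≤ C) (n : ℕ) :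
    ∫ p, ψ p ∂(averagedMeasure R κ n) = (n : ℝ)⁻¹ * ∫ p, birkhoffSum R ψ n p ∂κ := by
  rw [averagedMeasure, integral_smul_measure, integral_finsetSum_measure
    fun k _ => integrable_of_abs_le hψ hC]
  simp only [birkhoffSum]
  rw [integral_finsetSum (f := fun k p => ψ (R^[k] p)) _ fun k _ =>
    integrable_of_abs_le (hψ.comp (hR.iterate k)) fun p => hC _]
  simp only [ENNReal.toReal_inv, ENNReal.toReal_natCast, smul_eq_mul]
  congr 1
  exact Finset.sum_congr rfl fun k _ =>
    integral_map (hR.iterate k).aemeasurable hψ.aestronglyMeasurable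

/-- The sums telescope to `ψ ∘ R^[n] - ψ`. The averages are therefore asymptotically invariant. -/
lemma abs_integral_comp_sub_averagedMeasure_le [IsProbabilityMeasure κ] (hR : Measurable R)
    {ψ : Z → ℝ} (hψ : Measurable ψ) {C : ℝ} (hC : ∀ p, |ψ p| ≤ C) (n : ℕ) :
    |∫ p, ψ (R p) ∂(averagedMeasure R κ n) - ∫ p, ψ p ∂(averagedMeasure R κ n)|
      ≤ (n : ℝ)⁻¹ * (2 * C) := by
  have hsum (χ : Z → ℝ) (hχ : Measurable χ) (hχC : ∀ p, |χ p| ≤ C) :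
      Integrable (birkhoffSum R χ n) κ :=
    integrable_finsetSum _ fun k _ =>
      integrable_of_abs_le (hχ.comp (hR.iterate k)) fun p => hχC _
  rw [integral_averagedMeasure hR hψ hC,
    integral_averagedMeasure hR (ψ := fun p => ψ (R p)) (hψ.comp hR) (fun p => hC _), ← mul_sub,
    ← integral_sub (hsum (fun p => ψ (R p)) (hψ.comp hR) fun p => hC _) (hsum ψ hψ hC), abs_mul,
    abs_of_nonneg (by positivity : (0 : ℝ) ≤ (n : ℝ)⁻¹)]
  have h1 (p : Z) : birkhoffSum R (fun p => ψ (R p)) n p - birkhoffSum R ψ n p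
      = ψ (R^[n] p) - ψ p := by
    rw [← birkhoffSum_apply_sub_birkhoffSum]
    simp only [birkhoffSum, ← Function.iterate_succ_apply, ← Function.iterate_succ_apply']
  simp only [h1]
  gcongr
  have h2 := norm_integral_le_of_norm_le_const (μ := κ) (f := fun p => ψ (R^[n] p) - ψ p)
    (C := 2 * C) (Eventually.of_forall fun p => by
      rw [Real.norm_eq_abs]
      linarith [abs_sub (ψ (R^[n] p)) (ψ p), hC (R^[n] p), hC p])
  simpa using h2

lemma map_snd_averagedMeasure {X Y : Type*} [MeasurableSpace X] [MeasurableSpace Y] {S : X → X}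
    {T : Y → Y} {ν : Measure Y} (hS : Measurable S) (hT : MeasurePreserving T ν ν)
    {κ : Measure (X × Y)} (hκ : κ.map Prod.snd = ν) {n : ℕ} (hn : 0 < n) :
    (averagedMeasure (Prod.map S T) κ n).map Prod.snd = ν := by
  have hR : Measurable (Prod.map S T) := hS.prodMap hT.measurable
  rw [averagedMeasure, Measure.map_smul, Measure.map_finset_sum measurable_snd.aemeasurable]
  have h1 (k : ℕ) : (κ.map (Prod.map S T)^[k]).map Prod.snd = ν := by
    rw [Measure.map_map measurable_snd (hR.iterate k)]
    have h2 : (Prod.snd ∘ (Prod.map S T)^[k]) = T^[k] ∘ (Prod.snd : X × Y → Y) := by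
      rw [Prod.map_iterate]
      rfl
    rw [h2, ← Measure.map_map (hT.measurable.iterate k) measurable_snd, hκ]
    exact (hT.iterate k).map_eq
  simp only [h1]
  exact inv_smul_sum_range_const hn ν

end Empirical

/-! ### Cheap joinings for costs bounded below. -/

section Existence

variable {X Y : Type*} [TopologicalSpace X] [CompactSpace X] [TopologicalSpace.MetrizableSpace X]
  [Nonempty X] [MeasurableSpace X] [BorelSpace X] [TopologicalSpace Y] [PolishSpace Y]
  [MeasurableSpace Y] [BorelSpace Y] {S : X → X} {T : Y → Y} {ν : Measure Y}

/-- Near-minimizers of a continuous cost can be chosen measurably. -/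
lemma exists_measurable_birkhoffSum_le (hS : Continuous S) (hT : Measurable T)
    (φ : BoundedContinuousFunction (X × Y) ℝ) (n : ℕ) :
    ∃ ξ : Y → X, Measurable ξ ∧
      ∀ y, birkhoffSum (Prod.map S T) φ n (ξ y, y) ≤ minSum S T φ n y + 1 := by
  classical
  let D := TopologicalSpace.denseSeq X
  have hR : Measurable (Prod.map S T) := hS.measurable.prodMap hT
  have hmeas : Measurable (birkhoffSum (Prod.map S T) φ n) :=
    Finset.measurable_fun_sum _ fun k _ => φ.continuous.measurable.comp (hR.iterate k)
  have hex (y : Y) : ∃ i, birkhoffSum (Prod.map S T) φ n (D i, y) < minSum S T φ n y + 1 := by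
    have hcont : Continuous fun x => birkhoffSum (Prod.map S T) φ n (x, y) := by
      simp only [birkhoffSum_prodMap]
      exact continuous_finsetSum _ fun k _ =>
        φ.continuous.comp ((hS.iterate k).prodMk continuous_const)
    -- Continuity of `φ` makes the strict near-minimizers an open set, which meets the dense
    -- sequence; the least such index depends measurably on `y`.
    obtain ⟨x, hx⟩ := exists_lt_of_ciInf_lt (lt_add_one (minSum S T φ n y))
    obtain ⟨_, hz, ⟨i, rfl⟩⟩ := (TopologicalSpace.denseRange_denseSeq X).inter_open_nonempty _
      (isOpen_lt hcont continuous_const) ⟨x, hx⟩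
    exact ⟨i, hz⟩
  refine ⟨fun y => D (Nat.find (hex y)), ?_, fun y => (Nat.find_spec (hex y)).le⟩
  refine Measurable.find (f := fun i _ => D i) (fun i => measurable_const) (fun i => ?_) hex
  exact measurableSet_lt (hmeas.comp (measurable_const.prodMk measurable_id))
    ((measurable_minSum hS hT φ.continuous.lowerSemicontinuous n).add_const 1)

omit [CompactSpace X] [TopologicalSpace.MetrizableSpace X] [Nonempty X] in
lemma integrable_of_map_snd_eq {u : X × Y → ℝ} (hu : LowerSemicontinuous u) {h : Y → ℝ}
    (hh : Integrable h ν) (huh : ∀ x y, |u (x, y)| ≤ h y) {κ : Measure (X × Y)}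
    (hκ : κ.map Prod.snd = ν) : Integrable u κ := by
  rw [← hκ] at hh
  exact (hh.comp_measurable measurable_snd).mono' hu.measurable.aestronglyMeasurable
    (Eventually.of_forall fun p => huh p.1 p.2)

/-- Existence of a cheap joining for a lower semicontinuous cost that is bounded below. -/
lemma exists_measurePreserving_integral_le_of_bddBelow [IsProbabilityMeasure ν] (hS : Continuous S)
    (hT : MeasurePreserving T ν ν) {u : X × Y → ℝ} (hu : LowerSemicontinuous u) {B : ℝ}
    (hB : ∀ p, B ≤ u p) {h : Y → ℝ} (hh : Integrable h ν) (huh : ∀ x y, |u (x, y)| ≤ h y) {L : ℝ}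
    (hL : ∀ n : ℕ, ∫ y, minSum S T u n y ∂ν ≤ n * L) :
    ∃ l : ProbabilityMeasure (X × Y),
      MeasurePreserving (Prod.map S T) (l : Measure (X × Y)) (l : Measure (X × Y)) ∧
      (l : Measure (X × Y)).map Prod.snd = ν ∧ ∫ p, u p ∂(l : Measure (X × Y)) ≤ L := by
  obtain ⟨φ, hmono, hlow, hup, hlim⟩ := exists_monotone_boundedContinuous_tendsto hu hB
  have hR : Measurable (Prod.map S T) := hS.measurable.prodMap hT.measurable
  -- The approximation index and the horizon `n + 1` grow together; the slack 1 in near-minimality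
  -- becomes `1 / (n + 1)` after averaging.
  choose ξ hξ hξle using fun n : ℕ =>
    exists_measurable_birkhoffSum_le hS hT.measurable (φ n) (n + 1)
  let κ (n : ℕ) : Measure (X × Y) := ν.map fun y => (ξ n y, y)
  have hκm (n : ℕ) : Measurable fun y => (ξ n y, y) := (hξ n).prodMk measurable_id
  have hκp (n : ℕ) : IsProbabilityMeasure (κ n) :=
    Measure.isProbabilityMeasure_map (hκm n).aemeasurable
  have hκ (n : ℕ) : (κ n).map Prod.snd = ν := by
    rw [Measure.map_map measurable_snd (hκm n)]
    exact Measure.map_id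
  let lam (n : ℕ) : ProbabilityMeasure (X × Y) := ⟨averagedMeasure (Prod.map S T) (κ n) (n + 1),
    isProbabilityMeasure_averagedMeasure hR n.succ_pos⟩
  have hlam (n : ℕ) : (lam n : Measure (X × Y)).map Prod.snd = ν :=
    map_snd_averagedMeasure hS.measurable hT (hκ n) n.succ_pos
  have hcost (n : ℕ) : ∫ p, φ n p ∂(lam n : Measure (X × Y)) ≤ L + 1 / ((n : ℝ) + 1) := by
    have hbm : Measurable (birkhoffSum (Prod.map S T) (φ n) (n + 1)) :=
      Finset.measurable_fun_sum _ fun k _ => (φ n).continuous.measurable.comp (hR.iterate k)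
    have hmu := integrable_minSum hT hh huh (measurable_minSum hS hT.measurable hu (n + 1))
    have hbd (x : X) (y : Y) : |φ n (x, y)| ≤ ‖φ n‖ := (φ n).norm_coe_le_norm _
    have h1 : ∫ p, birkhoffSum (Prod.map S T) (φ n) (n + 1) p ∂(κ n)
        ≤ ∫ y, (minSum S T u (n + 1) y + 1) ∂ν := by
      rw [integral_map (hκm n).aemeasurable hbm.aestronglyMeasurable]
      refine integral_mono ?_ (hmu.add (integrable_const 1)) fun y => (hξle n y).trans ?_
      · refine integrable_of_abs_le (hbm.comp (hκm n)) (C := (n + 1 : ℕ) * ‖φ n‖) fun y => ?_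
        refine (abs_birkhoffSum_prodMap_le hbd (n + 1) (ξ n y) y).trans_eq ?_
        simp [birkhoffSum]
      · gcongr
        exact le_ciInf fun x => (minSum_le hbd _ x y).trans
          (Finset.sum_le_sum fun k _ => hup n _)
    rw [integral_add hmu (integrable_const 1)] at h1
    have h2 := hL (n + 1)
    have h3 : ∫ p, φ n p ∂(lam n : Measure (X × Y)) = ((n + 1 : ℕ) : ℝ)⁻¹ * _ :=
      integral_averagedMeasure hR (φ n).continuous.measurable (φ n).norm_coe_le_norm (n + 1)
    rw [h3, inv_mul_le_iff₀ (by positivity)]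
    refine h1.trans ?_
    push_cast at h2 ⊢
    simp only [integral_const, probReal_univ, smul_eq_mul, mul_one]
    have h4 : ((n : ℝ) + 1) * (L + 1 / ((n : ℝ) + 1)) = (n + 1) * L + 1 := by field_simp
    linarith
  obtain ⟨F, l, hF, hFle, hl⟩ := exists_tendsto_probabilityMeasure hlam
  have hsnd := map_snd_eq_of_tendsto hl hlam
  refine ⟨l, measurePreserving_of_tendsto hS hT hl hlam fun ψ hψ ⟨C, hC⟩ => ?_, hsnd, ?_⟩
  · refine squeeze_zero_norm
      (a := fun n : ℕ => ((n + 1 : ℕ) : ℝ)⁻¹ * (2 * C)) (fun n =>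
        abs_integral_comp_sub_averagedMeasure_le hR hψ hC (n + 1)) ?_
    have h1 := ((tendsto_add_atTop_iff_nat 1).2
      (tendsto_inv_atTop_nhds_zero_nat (𝕜 := ℝ))).mul_const (2 * C)
    rw [zero_mul] at h1
    exact h1.mono_left hFle
  · refine integral_le_of_tendsto (a := fun n : ℕ => L + 1 / ((n : ℝ) + 1)) hlow hup hlim hl
      (integrable_of_map_snd_eq hu hh huh hsnd) ?_ fun k => ?_
    · have h1 := (tendsto_one_div_add_atTop_nhds_zero_nat (𝕜 := ℝ)).const_add L
      rw [add_zero] at h1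
      exact h1.mono_left hFle
    -- For `n ≥ k` monotonicity gives `φ k ≤ φ n`, whose cost is controlled by `hcost`.
    · filter_upwards [hFle (eventually_ge_atTop k)] with n hn
      refine le_trans (integral_mono ?_ ?_ fun p => hmono p hn) (hcost n)
      · exact (φ k).integrable _
      · exact (φ n).integrable _

end Existence

/-! ### Removing the lower bound by truncation. -/

section Attained

/-- Invariance of the first marginal is automatic, since `Prod.fst` intertwines `S × T` with `S`. -/
lemma mem_joinings_iff {X Y : Type*} [MeasurableSpace X] [MeasurableSpace Y] {S : X → X} {T : Y → Y}
    {ν : Measure Y} (hS : Measurable S) {lam : Measure (X × Y)} :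
    lam ∈ joinings S T ν ↔ IsProbabilityMeasure lam ∧
      MeasurePreserving (Prod.map S T) lam lam ∧ lam.map Prod.snd = ν := by
  constructor
  · rintro ⟨μ, -, -, h⟩
    exact ⟨h.isProbabilityMeasure, h.measurePreserving, h.map_snd⟩
  · rintro ⟨h1, h2, h3⟩
    refine ⟨lam.map Prod.fst, Measure.isProbabilityMeasure_map measurable_fst.aemeasurable,
      ⟨hS, ?_⟩, h1, h2, rfl, h3⟩
    rw [Measure.map_map hS measurable_fst]
    have h4 : S ∘ (Prod.fst : X × Y → X) = Prod.fst ∘ Prod.map S T := rfl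
    rw [h4, ← Measure.map_map measurable_fst h2.measurable, h2.map_eq]

lemma integrable_max_sub_const {Y : Type*} [MeasurableSpace Y] {ν : Measure Y}
    [IsFiniteMeasure ν] {h : Y → ℝ} (hh : Integrable h ν) (M : ℕ) :
    Integrable (fun y => max (h y - M) 0) ν :=
  (hh.sub (integrable_const _)).sup (integrable_zero _ _ _)

lemma tendsto_integral_max_sub_const {Y : Type*} [MeasurableSpace Y] {ν : Measure Y}
    [IsFiniteMeasure ν] {h : Y → ℝ} (hh : Integrable h ν) :
    Tendsto (fun M : ℕ => ∫ y, max (h y - M) 0 ∂ν) atTop (𝓝 0) := by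
  have h1 := tendsto_integral_of_dominated_convergence (μ := ν)
    (F := fun (M : ℕ) y => max (h y - M) 0) (f := fun _ => 0) (fun y => |h y|)
    (fun M => (integrable_max_sub_const hh M).aestronglyMeasurable) hh.abs
    (fun M => Eventually.of_forall fun y => ?_) (Eventually.of_forall fun y => ?_)
  · simpa using h1
  · have hM : (0 : ℝ) ≤ M := M.cast_nonneg
    rw [Real.norm_eq_abs, abs_of_nonneg (le_max_right _ _)]
    exact max_le (by linarith [le_abs_self (h y)]) (abs_nonneg _)
  · refine tendsto_const_nhds.congr' ?_
    filter_upwards [tendsto_natCast_atTop_atTop.eventually_ge_atTop (h y)] with M hM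
    exact (max_eq_right (by linarith)).symm

lemma abs_max_neg_le {a b : ℝ} (hab : |a| ≤ b) (M : ℕ) : |max a (-(M : ℝ))| ≤ b := by
  have hM : (0 : ℝ) ≤ M := M.cast_nonneg
  have h1 := abs_le.1 hab
  exact abs_le.2 ⟨h1.1.trans (le_max_left _ _), max_le h1.2 (by linarith)⟩

lemma max_neg_le_add {a b : ℝ} (hab : |a| ≤ b) (M : ℕ) :
    max a (-(M : ℝ)) ≤ a + max (b - M) 0 := by
  have h1 := (abs_le.1 hab).1
  exact max_le (by linarith [le_max_right (b - M) 0]) (by linarith [le_max_left (b - M) 0])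

variable {X Y : Type*} [TopologicalSpace X] [CompactSpace X] [TopologicalSpace.MetrizableSpace X]
  [Nonempty X] [MeasurableSpace X] [BorelSpace X] [TopologicalSpace Y] [PolishSpace Y]
  [MeasurableSpace Y] [BorelSpace Y] {S : X → X} {T : Y → Y} {ν : Measure Y}

/-- If the mean minimal costs are at most `n L`, some joining has expected cost at most `L`. -/
lemma exists_measurePreserving_integral_le [IsProbabilityMeasure ν] (hS : Continuous S)
    (hT : MeasurePreserving T ν ν) {c : X × Y → ℝ} (hc : LowerSemicontinuous c)
    {h : Y → ℝ} (hh : Integrable h ν) (hch : ∀ x y, |c (x, y)| ≤ h y) {L : ℝ}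
    (hL : ∀ n : ℕ, ∫ y, minSum S T c n y ∂ν ≤ n * L) :
    ∃ l : ProbabilityMeasure (X × Y),
      MeasurePreserving (Prod.map S T) (l : Measure (X × Y)) (l : Measure (X × Y)) ∧
      (l : Measure (X × Y)).map Prod.snd = ν ∧ ∫ p, c p ∂(l : Measure (X × Y)) ≤ L := by
  -- Truncating `c` at `-M` raises it by at most `t M y`, whose ν-integral tends to 0.
  let t (M : ℕ) (y : Y) : ℝ := max (h y - M) 0
  let u (M : ℕ) (p : X × Y) : ℝ := max (c p) (-(M : ℝ))
  have ht (M : ℕ) : Integrable (t M) ν := integrable_max_sub_const hh M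
  have hu (M : ℕ) : LowerSemicontinuous (u M) :=
    hc.sup lowerSemicontinuous_const
  have huh (M : ℕ) (x : X) (y : Y) : |u M (x, y)| ≤ h y := abs_max_neg_le (hch x y) M
  have huB (M : ℕ) (p : X × Y) : -(M : ℝ) ≤ u M p := le_max_right _ _
  have huc (M : ℕ) (x : X) (y : Y) : u M (x, y) ≤ c (x, y) + t M y := max_neg_le_add (hch x y) M
  have hmin (M n : ℕ) : ∫ y, minSum S T (u M) n y ∂ν ≤ n * (L + ∫ y, t M y ∂ν) := by
    have hi := integrable_minSum hT hh hch (measurable_minSum hS hT.measurable hc n)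
    have hti := integrable_birkhoffSum hT (ht M) n
    have h1 : ∫ y, minSum S T (u M) n y ∂ν
        ≤ ∫ y, (minSum S T c n y + birkhoffSum T (t M) n y) ∂ν := by
      refine integral_mono
        (integrable_minSum hT hh (huh M) (measurable_minSum hS hT.measurable (hu M) n))
        (hi.add hti) fun y => ?_
      refine sub_le_iff_le_add.1 (le_ciInf fun x => ?_)
      have h2 := minSum_le (S := S) (T := T) (huh M) n x y
      have h3 : birkhoffSum (Prod.map S T) (u M) n (x, y)
          ≤ birkhoffSum (Prod.map S T) c n (x, y) + birkhoffSum T (t M) n y := by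
        rw [birkhoffSum_prodMap, birkhoffSum_prodMap, birkhoffSum, ← Finset.sum_add_distrib]
        exact Finset.sum_le_sum fun k _ => huc M _ _
      linarith
    rw [integral_add hi hti, integral_birkhoffSum hT (ht M)] at h1
    linarith [hL n]
  choose lam hinv hsnd hcost using fun M : ℕ =>
    exists_measurePreserving_integral_le_of_bddBelow hS hT (hu M) (huB M) hh (huh M) (hmin M)
  obtain ⟨F, l, hF, hFle, hl⟩ := exists_tendsto_probabilityMeasure hsnd
  have hlsnd := map_snd_eq_of_tendsto hl hsnd
  refine ⟨l, measurePreserving_of_tendsto hS hT hl hsnd fun ψ hψ _ => ?_, hlsnd, ?_⟩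
  · refine tendsto_const_nhds.congr fun n => (sub_eq_zero.2 ?_).symm
    rw [← integral_map (hinv n).aemeasurable hψ.aestronglyMeasurable, (hinv n).map_eq]
  have hlim := tendsto_integral_max_sub_const hh
  have hint {v : X × Y → ℝ} (hv : LowerSemicontinuous v) (hvh : ∀ x y, |v (x, y)| ≤ h y)
      {κ : Measure (X × Y)} (hκ : κ.map Prod.snd = ν) : Integrable v κ :=
    integrable_of_map_snd_eq hv hh hvh hκ
  -- With `M` fixed, `u M ≤ c + t M ≤ u n + t M` bounds the cost under `lam n`. The limit along `F`
  -- comes first, then `M → ∞`.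
  have hbound (M : ℕ) : ∫ p, c p ∂(l : Measure (X × Y)) ≤ L + 0 + ∫ y, t M y ∂ν := by
    refine (integral_mono (hint hc hch hlsnd) (hint (hu M) (huh M) hlsnd)
      fun p => le_max_left _ _).trans ?_
    obtain ⟨φ, -, hlow, hup, hφ⟩ := exists_monotone_boundedContinuous_tendsto (hu M) (huB M)
    refine integral_le_of_tendsto (a := fun n : ℕ => L + ∫ y, t n y ∂ν + ∫ y, t M y ∂ν) hlow hup hφ
      hl (hint (hu M) (huh M) hlsnd) (((hlim.const_add L).add_const _).mono_left hFle) fun k => ?_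
    refine Eventually.of_forall fun n => ?_
    have htM : Integrable (fun p : X × Y => t M p.2) (lam n : Measure (X × Y)) := by
      have h1 := ht M
      rw [← hsnd n] at h1
      exact h1.comp_measurable measurable_snd
    have htM' : ∫ p : X × Y, t M p.2 ∂(lam n : Measure (X × Y)) = ∫ y, t M y ∂ν := by
      have h1 := ht M
      rw [← hsnd n] at h1 ⊢
      rw [integral_map measurable_snd.aemeasurable h1.aestronglyMeasurable]
    calc ∫ p, φ k p ∂(lam n : Measure (X × Y))
        ≤ ∫ p, (u n p + t M p.2) ∂(lam n : Measure (X × Y)) :=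
          integral_mono ((φ k).integrable _) ((hint (hu n) (huh n) (hsnd n)).add htM) fun p =>
            (hup k p).trans ((huc M p.1 p.2).trans (by gcongr; exact le_max_left _ _))
      _ = ∫ p, u n p ∂(lam n : Measure (X × Y)) + ∫ y, t M y ∂ν := by
          rw [integral_add (hint (hu n) (huh n) (hsnd n)) htM, htM']
      _ ≤ _ := by gcongr; exact hcost n
  have h2 := hlim.const_add (L + 0)
  simp only [add_zero] at h2 hbound
  exact ge_of_tendsto' h2 hbound

end Attained

end Tracking

/-! ### The tracking theorem. -/

theorem theorem1 {X Y : Type*}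
    [MetricSpace X] [CompactSpace X] [Nonempty X] [MeasurableSpace X] [BorelSpace X]
    [TopologicalSpace Y] [PolishSpace Y] [MeasurableSpace Y] [BorelSpace Y]
    (S : X → X) (hS : Continuous S)
    (T : Y → Y) (ν : Measure Y) [IsProbabilityMeasure ν] (hT : Ergodic T ν)
    (c : X × Y → ℝ) (hc : LowerSemicontinuous c)
    (cstar : Y → ℝ) (hcstar : Integrable cstar ν) (hbound : ∀ x y, |c (x, y)| ≤ cstar y) :
    -- all the expected costs are genuine integrals, and `C(S : ν)` is their (finite) infimum
    (∀ lam ∈ Tracking.joinings S T ν, Integrable c lam) ∧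
    IsGLB (Tracking.joiningCosts S T ν c) (Tracking.optimalCost S T ν c) ∧
    -- almost sure convergence of the optimal average cost
    (∀ᵐ y ∂ν, Tendsto
      (fun n : ℕ => ⨅ x : X, (n : ℝ)⁻¹ * ∑ k ∈ Finset.range n, c (S^[k] x, T^[k] y))
      atTop (𝓝 (Tracking.optimalCost S T ν c))) ∧
    -- the infimum is attained
    (∃ lam ∈ Tracking.joinings S T ν, ∫ p, c p ∂lam = Tracking.optimalCost S T ν c) := by
  have hmp := hT.toMeasurePreserving
  have hmeas := Tracking.measurable_minSum hS hT.measurable hc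
  have hint : ∀ lam ∈ Tracking.joinings S T ν, Integrable c lam := fun lam hlam =>
    Tracking.integrable_of_map_snd_eq hc hcstar hbound
      ((Tracking.mem_joinings_iff hS.measurable).1 hlam).2.2
  -- The shift excludes horizon 0, whose value 0 would spoil the supremum for negative costs.
  let L : ℝ := ⨆ n : ℕ, ((n : ℝ) + 1)⁻¹ * ∫ y, Tracking.minSum S T c (n + 1) y ∂ν
  have hle : ∀ lam ∈ Tracking.joinings S T ν, ∀ n : ℕ,
      ((n : ℝ) + 1)⁻¹ * ∫ y, Tracking.minSum S T c (n + 1) y ∂ν ≤ ∫ p, c p ∂lam := by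
    intro lam hlam n
    obtain ⟨-, h1, h2⟩ := (Tracking.mem_joinings_iff hS.measurable).1 hlam
    rw [inv_mul_le_iff₀ (by positivity)]
    exact_mod_cast Tracking.integral_minSum_le hmp hcstar hbound (hmeas (n + 1)) h1 h2 (hint _ hlam)
  have hbdd : BddAbove (Set.range fun n : ℕ =>
      ((n : ℝ) + 1)⁻¹ * ∫ y, Tracking.minSum S T c (n + 1) y ∂ν) := by
    refine ⟨∫ y, cstar y ∂ν, ?_⟩
    rintro _ ⟨n, rfl⟩
    have h1 := integral_mono (Tracking.integrable_minSum hmp hcstar hbound (hmeas (n + 1)))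
      (Tracking.integrable_birkhoffSum hmp hcstar (n + 1))
      fun y => (le_abs_self _).trans (Tracking.abs_minSum_le hbound (n + 1) y)
    rw [Tracking.integral_birkhoffSum hmp hcstar] at h1
    simp only
    rw [inv_mul_le_iff₀ (by positivity)]
    exact_mod_cast h1
  obtain ⟨l, hl1, hl2, hl3⟩ := Tracking.exists_measurePreserving_integral_le hS hmp hc hcstar hbound
    (L := L) (fun n => by
      cases n with
      | zero => simp [Tracking.minSum]
      | succ n =>
        have h1 : ((n : ℝ) + 1)⁻¹ * ∫ y, Tracking.minSum S T c (n + 1) y ∂ν ≤ L := le_ciSup hbdd n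
        rw [inv_mul_le_iff₀ (by positivity)] at h1
        rwa [Nat.cast_succ])
  have hl : (l : Measure (X × Y)) ∈ Tracking.joinings S T ν :=
    (Tracking.mem_joinings_iff hS.measurable).2 ⟨inferInstance, hl1, hl2⟩
  have hleast : IsLeast (Tracking.joiningCosts S T ν c) (∫ p, c p ∂(l : Measure (X × Y))) := by
    refine ⟨⟨l, hl, rfl⟩, ?_⟩
    rintro _ ⟨lam, hlam, rfl⟩
    exact hl3.trans (ciSup_le (hle lam hlam))
  have hopt : Tracking.optimalCost S T ν c = ∫ p, c p ∂(l : Measure (X × Y)) := hleast.csInf_eq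
  refine ⟨hint, hopt ▸ hleast.isGLB, ?_, l, hl, hopt.symm⟩
  have hlow : ∀ᵐ y ∂ν, ∀ m : ℕ, ∀ r < ((m : ℝ) + 1)⁻¹ * ∫ y, Tracking.minSum S T c (m + 1) y ∂ν,
      ∀ᶠ n : ℕ in atTop, r < (n : ℝ)⁻¹ * Tracking.minSum S T c n y :=
    ae_all_iff.2 fun m => by
      exact_mod_cast Tracking.ae_forall_lt_eventually_lt_minSum hT hcstar hbound m.succ_pos
        (hmeas (m + 1))
  filter_upwards [hlow, Tracking.ae_forall_gt_eventually_minSum_lt hT hbound hmeas hl1 hl2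
    (hint l hl)] with y h1 h2
  have h3 (n : ℕ) : ⨅ x : X, (n : ℝ)⁻¹ * ∑ k ∈ Finset.range n, c (S^[k] x, T^[k] y)
      = (n : ℝ)⁻¹ * Tracking.minSum S T c n y := by
    rw [Tracking.minSum, Real.mul_iInf_of_nonneg (by positivity)]
    simp only [Tracking.birkhoffSum_prodMap]
  simp only [h3, hopt]
  refine tendsto_order.2 ⟨fun r hr => ?_, h2⟩
  -- Since `r` lies below the optimal cost, hence below `L`, one block length already exceeds it on
  -- average.
  obtain ⟨m, hm⟩ := exists_lt_of_lt_ciSup (hr.trans_le hl3)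
  exact h1 m r hm
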